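/- Let $n\ge 2$, let $\Omega\subset\mathbb{R}^n$ be a bounded domain (non-empty, open, connected) with volume $|\Omega|$, and let $l\ge 1$ be an integer. Let $0<\lambda_1\le\lambda_2\le\cdots$ be the eigenvalues, repeated according to multiplicity, of the Dirichlet problem for the polyharmonic operator $$(-\Delta)^l u=\lambda u \ \text{ in } \Omega,\qquad u=\frac{\partial u}{\partial\nu}=\cdots=\frac{\partial^{l-1}u}{\partial\nu^{l-1}}=0\ \text{ on }\partial\Omega,$$ understood weakly: $u\in H^l_0(\Omega)\setminus\{0\}$ and the equation holds in the sense of distributions on $\Omega$. Then for every $0<q\le 1$ and every integer $k\ge 0$, $$\sum_{j=1}^k\lambda_j^{\,q}\ \ge\ \frac{n}{n+2lq}\,(4\pi)^{lq}\left(\frac{\Gamma(1+\frac n2)}{|\Omega|}\right)^{\frac{2lq}{n}}k^{1+\frac{2lq}{n}}.$$ -/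

import Mathlib

open MeasureTheory Filter Topology TopologicalSpace
open scoped ENNReal Distributions LineDeriv Laplacian

noncomputable section

namespace Polyharmonic

/-- The complex Hilbert space `L²(Ω)` of an open set `Ω ⊆ ℝⁿ` (Lebesgue measure). -/
abbrev L2 {n : ℕ} (Ω : Opens (EuclideanSpace ℝ (Fin n))) : Type :=
  Lp ℂ 2 ((volume : Measure (EuclideanSpace ℝ (Fin n))).restrict Ω)

/-- The partial derivative `∂_{α 0} ∂_{α 1} ⋯ ∂_{α (m-1)} φ` of a test function `φ ∈ C_c^∞(Ω)`,
where `∂_i` is the derivative along the `i`-th coordinate vector. -/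
def partialDeriv {n m : ℕ} {Ω : Opens (EuclideanSpace ℝ (Fin n))}
    (α : Fin m → Fin n) (φ : 𝓓(Ω, ℂ)) : 𝓓(Ω, ℂ) :=
  ∂^{fun i => EuclideanSpace.single (α i) (1 : ℝ)} φ

/-- `v` is the weak partial derivative `∂_{α 0} ⋯ ∂_{α (m-1)} u` of `u` on `Ω`. -/
def IsWeakPartialDeriv {n m : ℕ} {Ω : Opens (EuclideanSpace ℝ (Fin n))}
    (α : Fin m → Fin n) (u v : L2 Ω) : Prop :=
  ∀ φ : 𝓓(Ω, ℂ),
    ∫ x in Ω, u x * partialDeriv α φ x = (-1 : ℂ) ^ m * ∫ x in Ω, v x * φ x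

/-- `u ∈ H₀ˡ(Ω)`: the weak derivatives of `u` of all orders `m ≤ l` exist in `L²(Ω)`, and `u` is a
limit of functions of `C_c^∞(Ω)` in the norm of `Hˡ(Ω)`, that is, all partial derivatives
of order `m ≤ l` of these functions converge in `L²(Ω)` to those of `u`. -/
def MemH0 {n : ℕ} {Ω : Opens (EuclideanSpace ℝ (Fin n))} (l : ℕ) (u : L2 Ω) : Prop :=
  ∃ v : (m : ℕ) → (Fin m → Fin n) → L2 Ω,
    (∀ m ≤ l, ∀ α : Fin m → Fin n, IsWeakPartialDeriv α u (v m α)) ∧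
    ∃ φ : ℕ → 𝓓(Ω, ℂ), ∀ m ≤ l, ∀ α : Fin m → Fin n,
      Tendsto (fun i => eLpNorm (fun x => partialDeriv α (φ i) x - v m α x) 2
        ((volume : Measure (EuclideanSpace ℝ (Fin n))).restrict Ω)) atTop (𝓝 0)

/-- The operator `(-Δ)ˡ` on functions `ℝⁿ → ℂ` (applied to smooth functions only). -/
def negLaplacianPow {n : ℕ} (l : ℕ) (f : EuclideanSpace ℝ (Fin n) → ℂ) :
    EuclideanSpace ℝ (Fin n) → ℂ :=
  (fun g : EuclideanSpace ℝ (Fin n) → ℂ => -Δ g)^[l] f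

/-- `u` is an eigenfunction with eigenvalue `ν` of the Dirichlet problem
`(-Δ)ˡ u = ν u` in `Ω`, with `u` and its normal derivatives of order at most `l - 1` vanishing on
`∂Ω`: the boundary conditions mean `u ∈ H₀ˡ(Ω)`, and the equation holds in the sense of distributions on `Ω`. -/
def IsDirichletEigenfunction {n : ℕ} {Ω : Opens (EuclideanSpace ℝ (Fin n))}
    (l : ℕ) (ν : ℝ) (u : L2 Ω) : Prop :=
  u ≠ 0 ∧ MemH0 l u ∧
    ∀ φ : 𝓓(Ω, ℂ),
      ∫ x in Ω, u x * negLaplacianPow l φ x = (ν : ℂ) * ∫ x in Ω, u x * φ x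

/-- The `k`-th Dirichlet eigenvalue `λ_k` (`k ≥ 1`) of `(-Δ)ˡ` on `Ω`, counted with multiplicity:
the least `μ` such that there are `k` linearly independent eigenfunctions with eigenvalues at
most `μ` (and `∞` if there is no such `μ`). -/
def dirichletEigenvalue {n : ℕ} (Ω : Opens (EuclideanSpace ℝ (Fin n))) (l k : ℕ) : ℝ≥0∞ :=
  ⨅ (μ : ℝ) (_ : ∃ u : Fin k → L2 Ω, LinearIndependent ℂ u ∧
    ∀ i, ∃ ν ≤ μ, IsDirichletEigenfunction l ν (u i)), ENNReal.ofReal μ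

end Polyharmonic

end

/-!
Let `u₁, …, u_k` be orthonormal in `L²(Ω)`, extended by zero. As `û_j(ξ)` is the inner product of
`u_j` with a plane wave of squared norm `|Ω|`, Bessel's inequality gives `∑ |û_j|² ≤ |Ω|`, while
Plancherel's theorem gives `∫ ∑ |û_j|² = k`. Under these two constraints the moment
`∑ ∫ (2π|ξ|)^{2lq} |û_j(ξ)|² dξ` is least when all the mass fills a ball around the origin, which
yields the right-hand side of the theorem. If the `u_j` are eigenfunctions, `|û_j|²` is a
probability density for which the mean of `(2π|ξ|)^{2l}` is the eigenvalue, so by Jensen's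
inequality for the concave function `t ↦ t^q` the moment is at most `∑ λ_j^q`.

The eigenfunctions furnished by the definition of `λ_1, …, λ_k` are not orthonormal, and for each
`j` they form an unrelated family; exchange and Gram–Schmidt repair this, because eigenspaces for
different eigenvalues are orthogonal.
-/

noncomputable section

namespace Polyharmonic

open SchwartzMap FourierTransform Module

section Bathtub

variable {X : Type*} [MeasurableSpace X] {μ : Measure X}

theorem lintegral_rpow_mul_le {W ρ : X → ℝ≥0∞} (hW : AEMeasurable W μ) (hρ : AEMeasurable ρ μ)
    (hρ1 : ∫⁻ x, ρ x ∂μ = 1) {q : ℝ} (hq : 0 ≤ q) (hq1 : q ≤ 1) :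
    ∫⁻ x, W x ^ q * ρ x ∂μ ≤ (∫⁻ x, W x * ρ x ∂μ) ^ q := by
  have holder := ENNReal.lintegral_mul_norm_pow_le (hW.mul hρ) hρ hq (sub_nonneg.mpr hq1) (by ring)
  rw [hρ1, ENNReal.one_rpow, mul_one] at holder
  refine le_trans (le_of_eq (lintegral_congr fun x => ?_)) holder
  rw [Pi.mul_apply, ENNReal.mul_rpow_of_nonneg _ _ hq, mul_assoc,
    ← ENNReal.rpow_add_of_nonneg _ _ hq (sub_nonneg.mpr hq1), add_sub_cancel, ENNReal.rpow_one]

theorem mul_setLIntegral_le_lintegral_mul {F W : X → ℝ≥0∞} {B : Set X} {c M : ℝ≥0∞}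
    (hB : MeasurableSet B) (hW : Measurable W) (hF : AEMeasurable F μ)
    (hWB : ∀ x ∈ B, W x ≤ c) (hWB' : ∀ x ∉ B, c ≤ W x) (hFM : ∀ x, F x ≤ M) (hc : c ≠ ∞)
    (hmass : ∫⁻ x, F x ∂μ = M * μ B) (hfin : M * μ B ≠ ∞) :
    M * ∫⁻ x in B, W x ∂μ ≤ ∫⁻ x, W x * F x ∂μ := by
  -- `(W - c) * (F - M * 1_B) ≥ 0`, expanded and with all terms moved so that none is subtracted
  have pointwise : ∀ x, B.indicator (fun x => M * W x) x + c * F x ≤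
      W x * F x + B.indicator (fun _ => c * M) x := fun x => by
    by_cases hx : x ∈ B
    · obtain ⟨d, hd⟩ := exists_add_of_le (hWB x hx)
      simp only [Set.indicator_of_mem hx, hd]
      calc M * W x + (W x + d) * F x = W x * F x + (W x * M + d * F x) := by ring
        _ ≤ W x * F x + (W x * M + d * M) := by gcongr; exact hFM x
        _ = _ := by ring
    · simp only [Set.indicator_of_notMem hx, zero_add, add_zero]
      gcongr
      exact hWB' x hx
  have h := lintegral_mono (μ := μ) pointwise
  rw [lintegral_add_left ((hW.const_mul M).indicator hB),
    lintegral_add_left' (f := fun x => W x * F x) (hW.aemeasurable.mul hF),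
    lintegral_indicator hB, lintegral_indicator hB, lintegral_const_mul _ hW,
    lintegral_const_mul'' _ hF, hmass, setLIntegral_const,
    mul_assoc c M] at h
  exact (ENNReal.add_le_add_iff_right (ENNReal.mul_ne_top hc hfin)).mp h

end Bathtub

section Ball

variable {E : Type*} [NormedAddCommGroup E] [NormedSpace ℝ E] [FiniteDimensional ℝ E]
  [Nontrivial E] [MeasurableSpace E] [BorelSpace E] (μ : Measure E) [μ.IsAddHaarMeasure]

theorem setIntegral_ball_norm_rpow {s R : ℝ} (hs : 0 ≤ s) (hR : 0 ≤ R) :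
    ∫ x in Metric.ball (0 : E) R, ‖x‖ ^ s ∂μ =
      finrank ℝ E / (finrank ℝ E + s) * μ.real (Metric.ball 0 1) * R ^ (finrank ℝ E + s) := by
  set d := finrank ℝ E
  have hd1 : 1 ≤ d := finrank_pos
  have hd0 : (0 : ℝ) < d := by exact_mod_cast hd1
  have radial : ∫ y in Set.Ioi (0 : ℝ), y ^ (d - 1) • (Set.Iio R).indicator (· ^ s) y =
      R ^ (d + s) / (d + s) := by
    have integrand : ∀ y ∈ Set.Ioi (0 : ℝ), y ^ (d - 1) • (Set.Iio R).indicator (· ^ s) y =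
        (Set.Iio R).indicator (fun y : ℝ => y ^ ((d : ℝ) - 1 + s)) y := fun y hy => by
      by_cases hyR : y ∈ Set.Iio R
      · rw [Set.indicator_of_mem hyR, Set.indicator_of_mem hyR, smul_eq_mul,
          Real.rpow_add hy, ← Real.rpow_natCast, Nat.cast_sub hd1, Nat.cast_one]
      · rw [Set.indicator_of_notMem hyR, Set.indicator_of_notMem hyR, smul_zero]
    rw [setIntegral_congr_fun measurableSet_Ioi integrand, setIntegral_indicator measurableSet_Iio,
      Set.Ioi_inter_Iio, ← integral_Ioc_eq_integral_Ioo, ← intervalIntegral.integral_of_le hR,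
      integral_rpow (Or.inl (by linarith)), show (d : ℝ) - 1 + s + 1 = d + s by ring,
      Real.zero_rpow (by linarith), sub_zero]
  calc ∫ x in Metric.ball (0 : E) R, ‖x‖ ^ s ∂μ
      = ∫ x, (Set.Iio R).indicator (· ^ s) ‖x‖ ∂μ := by
        rw [← integral_indicator Metric.isOpen_ball.measurableSet]
        exact integral_congr_ae (.of_forall fun x => by simp [Set.indicator])
    _ = d • μ.real (Metric.ball 0 1) • (R ^ (d + s) / (d + s)) := by
        rw [integral_fun_norm_addHaar, radial]
    _ = _ := by rw [nsmul_eq_mul, smul_eq_mul]; ring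

theorem setLIntegral_ball_norm_rpow {s R : ℝ} (hs : 0 ≤ s) (hR : 0 ≤ R) :
    ∫⁻ x in Metric.ball (0 : E) R, ENNReal.ofReal (‖x‖ ^ s) ∂μ =
      ENNReal.ofReal
        (finrank ℝ E / (finrank ℝ E + s) * μ.real (Metric.ball 0 1) * R ^ (finrank ℝ E + s)) := by
  have : ContinuousOn (fun x : E => ‖x‖ ^ s) (Metric.closedBall 0 R) :=
    (continuous_norm.rpow_const fun _ => Or.inr hs).continuousOn
  rw [← setIntegral_ball_norm_rpow μ hs hR, ofReal_integral_eq_lintegral_ofReal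
    ((this.integrableOn_compact (isCompact_closedBall 0 R)).mono_set Metric.ball_subset_closedBall)
    (.of_forall fun x => by positivity)]

/-- The Li–Yau lower bound for the moment of order `s` of a density on a `d`-dimensional space of
total mass `m` and bounded by `M`, where `ω` is the volume of the unit ball. -/
def liYauBound (d : ℕ) (ω s m M : ℝ) : ℝ :=
  d / (d + s) * m ^ (1 + s / d) / (M * ω) ^ (s / d)

theorem ofReal_liYauBound_le_lintegral {F : E → ℝ≥0∞} (hF : AEMeasurable F μ) {s m M : ℝ}
    (hs : 0 ≤ s) (hm : 0 ≤ m) (hM : 0 < M) (hFM : ∀ x, F x ≤ ENNReal.ofReal M)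
    (hmass : ∫⁻ x, F x ∂μ = ENNReal.ofReal m) :
    ENNReal.ofReal (liYauBound (finrank ℝ E) (μ.real (Metric.ball 0 1)) s m M) ≤
      ∫⁻ x, ENNReal.ofReal (‖x‖ ^ s) * F x ∂μ := by
  set d := finrank ℝ E with hd
  set ω := μ.real (Metric.ball 0 1) with hω
  have hd0 : (0 : ℝ) < d := by exact_mod_cast (finrank_pos : 0 < finrank ℝ E)
  have hω0 : 0 < ω := ENNReal.toReal_pos (Metric.measure_ball_pos μ 0 one_pos).ne'
    measure_ball_lt_top.ne
  -- the radius of the ball on which the constant density `M` has mass `m`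
  set R : ℝ := (m / (M * ω)) ^ (1 / d : ℝ) with hR
  have hR0 : 0 ≤ R := by positivity
  have hRd : R ^ (d : ℝ) = m / (M * ω) := by
    rw [hR, ← Real.rpow_mul (by positivity), one_div_mul_cancel hd0.ne', Real.rpow_one]
  have hball : ENNReal.ofReal M * μ (Metric.ball 0 R) = ENNReal.ofReal m := by
    rw [Measure.addHaar_ball _ _ hR0, ← hd, ← ofReal_measureReal measure_ball_lt_top.ne, ← hω,
      ← ENNReal.ofReal_mul (by positivity), ← ENNReal.ofReal_mul hM.le, ← Real.rpow_natCast, hRd]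
    congr 1
    field_simp
  have bathtub := mul_setLIntegral_le_lintegral_mul (W := fun x => ENNReal.ofReal (‖x‖ ^ s))
    (c := ENNReal.ofReal (R ^ s)) measurableSet_ball (by fun_prop) hF
    (fun x hx => by gcongr; exact (mem_ball_zero_iff.mp hx).le)
    (fun x hx => by gcongr; simpa using hx)
    hFM ENNReal.ofReal_ne_top (hmass.trans hball.symm) (hball ▸ ENNReal.ofReal_ne_top)
  refine le_trans (le_of_eq ?_) bathtub
  rw [setLIntegral_ball_norm_rpow μ hs hR0, ← ENNReal.ofReal_mul hM.le]
  have hRs : R ^ (d + s) = (m / (M * ω)) ^ (1 + s / d) := by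
    rw [hR, ← Real.rpow_mul (by positivity)]
    congr 1
    field_simp
  rw [liYauBound, ← hd, ← hω, hRs, Real.div_rpow hm (by positivity),
    Real.rpow_one_add' (x := M * ω) (by positivity) (by positivity)]
  congr 1
  field_simp

end Ball

theorem two_pi_rpow_mul_liYauBound {n : ℕ} (hn : 0 < n) {s m M : ℝ} (hM : 0 ≤ M) :
    (2 * Real.pi) ^ s * liYauBound n
        ((volume : Measure (EuclideanSpace ℝ (Fin n))).real (Metric.ball 0 1)) s m M =
      n / (n + s) * (4 * Real.pi) ^ (s / 2) * (Real.Gamma (1 + n / 2) / M) ^ (s / n) *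
        m ^ (1 + s / n) := by
  have hπ := Real.pi_pos
  have : (0 : ℝ) < n := by exact_mod_cast hn
  have : Nonempty (Fin n) := ⟨⟨0, hn⟩⟩
  set G := Real.Gamma (1 + n / 2) with hG
  have : 0 < G := Real.Gamma_pos_of_pos (by positivity)
  have hω : (volume : Measure (EuclideanSpace ℝ (Fin n))).real (Metric.ball 0 1) =
      Real.pi ^ (n / 2 : ℝ) / G := by
    rw [Measure.real, EuclideanSpace.volume_ball, Fintype.card_fin, ENNReal.ofReal_one, one_pow,
      one_mul, add_comm _ (1 : ℝ), ← hG, ENNReal.toReal_ofReal (by positivity), Real.sqrt_eq_rpow,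
      ← Real.rpow_natCast, ← Real.rpow_mul hπ.le, one_div_mul_eq_div]
  have hpow : (M * (Real.pi ^ (n / 2 : ℝ) / G)) ^ (s / n) =
      Real.pi ^ (s / 2) / (G / M) ^ (s / n) := by
    rw [show M * (Real.pi ^ (n / 2 : ℝ) / G) = Real.pi ^ (n / 2 : ℝ) / (G / M) by
        rw [div_div_eq_mul_div, mul_comm M, div_mul_eq_mul_div],
      Real.div_rpow (by positivity) (by positivity), ← Real.rpow_mul hπ.le,
      show (n : ℝ) / 2 * (s / n) = s / 2 by field_simp]
  have hfour : (2 * Real.pi) ^ s = (4 * Real.pi) ^ (s / 2) * Real.pi ^ (s / 2) := by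
    rw [← Real.mul_rpow (by positivity) (by positivity),
      show 4 * Real.pi * Real.pi = (2 * Real.pi) ^ (2 : ℝ) by rw [Real.rpow_two]; ring,
      ← Real.rpow_mul (by positivity), mul_div_cancel₀ s two_ne_zero]
  rw [liYauBound, hω, hpow, hfour]
  field_simp

section Fourier

variable {V F : Type*} [NormedAddCommGroup V] [InnerProductSpace ℝ V] [FiniteDimensional ℝ V]
  [MeasurableSpace V] [BorelSpace V]

section Plancherel

variable [NormedAddCommGroup F]

theorem lintegral_enorm_sq {X : Type*} [MeasurableSpace X] {μ : Measure X} (f : Lp F 2 μ) :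
    ∫⁻ x, ‖f x‖ₑ ^ 2 ∂μ = ‖f‖ₑ ^ 2 := by
  have h := eLpNorm_nnreal_pow_eq_lintegral (f := f) (μ := μ) (p := 2) two_ne_zero
  simpa only [NNReal.coe_ofNat, ENNReal.coe_ofNat, ENNReal.rpow_ofNat, Lp.enorm_def] using h.symm

variable [InnerProductSpace ℂ F]

theorem continuous_fourier_of_integrable {f : V → F} (hf : Integrable f) : Continuous (𝓕 f) :=
  VectorFourier.fourierIntegral_continuous Real.continuous_fourierChar
    (L := innerₗ V) continuous_inner hf

variable [CompleteSpace F]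

theorem coeFn_fourier_ae_eq {f : Lp F 2 (volume : Measure V)} (hf : Integrable f) :
    (𝓕 f : Lp F 2 (volume : Measure V)) =ᵐ[volume] 𝓕 (f : V → F) := by
  refine ae_eq_of_integral_contDiff_smul_eq
    ((Lp.memLp _).locallyIntegrable (by norm_num))
    (continuous_fourier_of_integrable hf).locallyIntegrable fun g hg hgc => ?_
  let G : 𝓢(V, ℂ) := HasCompactSupport.toSchwartzMap (f := fun x => (g x : ℂ))
    (hgc.comp_left Complex.ofReal_zero) (Complex.ofRealCLM.contDiff.comp hg)
  have hG : ∀ (x : V) (y : F), G x • y = g x • y := fun x y => Complex.coe_smul (g x) y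
  calc ∫ ξ, g ξ • 𝓕 f ξ
      = ∫ ξ, G ξ • 𝓕 f ξ := by simp only [hG]
    _ = ∫ x, 𝓕 G x • f x := by
        rw [← Lp.toTemperedDistribution_apply, ← Lp.fourier_toTemperedDistribution_eq,
          TemperedDistribution.fourier_apply, Lp.toTemperedDistribution_apply]
    _ = ∫ ξ, G ξ • 𝓕 (f : V → F) ξ := by
        rw [SchwartzMap.fourier_coe]
        exact (VectorFourier.integral_fourierIntegral_smul_eq_flip (L := innerₗ V)
          Real.continuous_fourierChar continuous_inner G.integrable hf).trans
          (by rw [flip_innerₗ]; rfl)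
    _ = ∫ ξ, g ξ • 𝓕 (f : V → F) ξ := by simp only [hG]

theorem lintegral_enorm_fourier_sq {f : V → F} (hf : Integrable f) (hf2 : MemLp f 2) :
    ∫⁻ ξ, ‖𝓕 f ξ‖ₑ ^ 2 = ∫⁻ x, ‖f x‖ₑ ^ 2 := by
  have hae := hf2.coeFn_toLp
  have hfourier : 𝓕 f = 𝓕 (hf2.toLp f : V → F) := by
    ext ξ
    rw [Real.fourier_eq, Real.fourier_eq]
    refine integral_congr_ae ?_
    filter_upwards [hae] with x hx
    rw [hx]
  calc ∫⁻ ξ, ‖𝓕 f ξ‖ₑ ^ 2 = ∫⁻ ξ, ‖𝓕 (hf2.toLp f) ξ‖ₑ ^ 2 := by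
        refine lintegral_congr_ae ?_
        filter_upwards [coeFn_fourier_ae_eq (hf.congr hae.symm)] with ξ hξ
        rw [hξ, hfourier]
    _ = ‖hf2.toLp f‖ₑ ^ 2 := by
        rw [lintegral_enorm_sq, ← ofReal_norm, Lp.norm_fourier_eq, ofReal_norm]
    _ = ∫⁻ x, ‖f x‖ₑ ^ 2 := by
        rw [← lintegral_enorm_sq]
        refine lintegral_congr_ae ?_
        filter_upwards [hae] with x hx
        rw [hx]

end Plancherel

section FiniteMeasure

variable {A : Set V}

/-- The Fourier transform of the extension by zero of a square integrable function on `A`. -/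
def fourierOn (u : Lp ℂ 2 ((volume : Measure V).restrict A)) : V → ℂ :=
  𝓕 (A.indicator u)

variable [IsFiniteMeasure ((volume : Measure V).restrict A)]

theorem memLp_planeWave (ξ : V) :
    MemLp (fun x : V => (Real.fourierChar (inner ℝ x ξ) : ℂ)) 2
      ((volume : Measure V).restrict A) :=
  MemLp.of_bound (by fun_prop) 1 (.of_forall fun x => (Circle.norm_coe _).le)

variable (A) in
/-- The plane wave `x ↦ exp (2πi ⟪x, ξ⟫)` in `L²(A)`. -/
def planeWave (ξ : V) : Lp ℂ 2 ((volume : Measure V).restrict A) := (memLp_planeWave ξ).toLp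

theorem enorm_planeWave_sq (ξ : V) : ‖planeWave A ξ‖ₑ ^ 2 = volume A := by
  rw [← lintegral_enorm_sq, ← Measure.restrict_apply_univ A, ← lintegral_one]
  refine lintegral_congr_ae ?_
  filter_upwards [(memLp_planeWave (A := A) ξ).coeFn_toLp] with x hx
  rw [planeWave, hx, ← ofReal_norm, Circle.norm_coe, ENNReal.ofReal_one, one_pow]

theorem fourierOn_eq_inner (hA : MeasurableSet A) (u : Lp ℂ 2 ((volume : Measure V).restrict A))
    (ξ : V) : fourierOn u ξ = inner ℂ (planeWave A ξ) u := by
  rw [fourierOn, Real.fourier_eq, L2.inner_def, ← integral_indicator hA]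
  refine integral_congr_ae ?_
  filter_upwards [(ae_restrict_iff' hA).mp (memLp_planeWave (A := A) ξ).coeFn_toLp] with x hx
  by_cases hxA : x ∈ A
  · rw [Set.indicator_of_mem hxA, Set.indicator_of_mem hxA, planeWave, hx hxA, RCLike.inner_apply,
      Circle.smul_def, smul_eq_mul, AddChar.map_neg_eq_inv, Circle.coe_inv_eq_conj, mul_comm]
  · rw [Set.indicator_of_notMem hxA, Set.indicator_of_notMem hxA, smul_zero]

theorem continuous_fourierOn (hA : MeasurableSet A)
    (u : Lp ℂ 2 ((volume : Measure V).restrict A)) : Continuous (fourierOn u) :=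
  continuous_fourier_of_integrable <|
    (integrable_indicator_iff hA).mpr ((Lp.memLp u).integrable (by norm_num))

theorem lintegral_enorm_fourierOn_sq (hA : MeasurableSet A)
    (u : Lp ℂ 2 ((volume : Measure V).restrict A)) :
    ∫⁻ ξ, ‖fourierOn u ξ‖ₑ ^ 2 = ‖u‖ₑ ^ 2 := by
  rw [fourierOn, lintegral_enorm_fourier_sq
      ((integrable_indicator_iff hA).mpr ((Lp.memLp u).integrable (by norm_num)))
      ((memLp_indicator_iff_restrict hA).mpr (Lp.memLp u)),
    ← lintegral_enorm_sq, ← lintegral_indicator hA]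
  exact lintegral_congr fun x => by by_cases hx : x ∈ A <;> simp [hx]

theorem sum_enorm_fourierOn_sq_le {ι : Type*} [Fintype ι] (hA : MeasurableSet A)
    {u : ι → Lp ℂ 2 ((volume : Measure V).restrict A)} (hu : Orthonormal ℂ u) (ξ : V) :
    ∑ j, ‖fourierOn (u j) ξ‖ₑ ^ 2 ≤ volume A := by
  have bessel := ENNReal.ofReal_le_ofReal
    (hu.sum_inner_products_le (planeWave A ξ) (s := Finset.univ))
  rw [ENNReal.ofReal_sum_of_nonneg fun _ _ => by positivity] at bessel
  simpa only [fourierOn_eq_inner hA, ← enorm_planeWave_sq (A := A) ξ, ← ofReal_norm,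
    ← ENNReal.ofReal_pow (norm_nonneg _), norm_inner_symm (planeWave A ξ)] using bessel

theorem ofReal_liYauBound_le_sum_lintegral [Nontrivial V] {ι : Type*} [Fintype ι]
    (hA : MeasurableSet A) (hA0 : volume A ≠ 0)
    {u : ι → Lp ℂ 2 ((volume : Measure V).restrict A)} (hu : Orthonormal ℂ u)
    {s : ℝ} (hs : 0 ≤ s) :
    ENNReal.ofReal (liYauBound (finrank ℝ V) ((volume : Measure V).real (Metric.ball 0 1)) s
        (Fintype.card ι) ((volume : Measure V).real A)) ≤
      ∑ j, ∫⁻ ξ, ENNReal.ofReal (‖ξ‖ ^ s) * ‖fourierOn (u j) ξ‖ₑ ^ 2 := by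
  have hAfin : volume A ≠ ∞ := by
    simpa using measure_ne_top ((volume : Measure V).restrict A) Set.univ
  have hmeas : ∀ j, Measurable fun ξ => ‖fourierOn (u j) ξ‖ₑ ^ 2 := fun j =>
    (continuous_fourierOn hA (u j)).measurable.enorm.pow_const 2
  rw [← lintegral_finsetSum _ fun j _ => by have := hmeas j; fun_prop]
  simp only [← Finset.mul_sum]
  refine ofReal_liYauBound_le_lintegral _ (Finset.aemeasurable_fun_sum _ fun j _ =>
    (hmeas j).aemeasurable) hs (Nat.cast_nonneg _) (ENNReal.toReal_pos hA0 hAfin)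
    (fun ξ => ?_) ?_
  · rw [ofReal_measureReal hAfin]
    exact sum_enorm_fourierOn_sq_le hA hu ξ
  · rw [lintegral_finsetSum _ fun j _ => hmeas j]
    have hnorm : ∀ j, ‖u j‖ₑ = 1 := fun j => by rw [← ofReal_norm, hu.1 j, ENNReal.ofReal_one]
    simp [lintegral_enorm_fourierOn_sq hA, hnorm]

end FiniteMeasure

end Fourier

theorem exists_linearIndependent_forall_mem {R V : Type*} [DivisionRing R] [AddCommGroup V]
    [Module R V] {k : ℕ} (S : Fin k → Set V)
    (hS : ∀ j : Fin k, ∃ u : Fin (j + 1) → V, LinearIndependent R u ∧ ∀ i, u i ∈ S j) :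
    ∃ v : Fin k → V, LinearIndependent R v ∧ ∀ j, v j ∈ S j := by
  induction k with
  | zero => exact ⟨Fin.elim0, linearIndependent_empty_type, fun j => j.elim0⟩
  | succ k ih =>
    obtain ⟨v, hv, hvS⟩ := ih (fun j => S j.castSucc) fun j => hS j.castSucc
    obtain ⟨u, hu, huS⟩ := hS (Fin.last k)
    obtain ⟨i, hi⟩ : ∃ i, u i ∉ Submodule.span R (Set.range v) := by
      by_contra! hspan
      classical
      have hcard := linearIndependent_le_span' u hu (Set.range v) (Set.range_subset_iff.mpr hspan)
      rw [Cardinal.mk_fin, Nat.cast_le, Fin.val_last] at hcard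
      have := hcard.trans (Fintype.card_range_le v)
      simp at this
    refine ⟨Fin.snoc v (u i), linearIndependent_finSnoc.mpr ⟨hv, hi⟩, fun j => ?_⟩
    induction j using Fin.lastCases with
    | last => simpa using huS i
    | cast j => simpa using hvS j

section Orthonormalization

variable {𝕜 H ι κ : Type*} [RCLike 𝕜] [NormedAddCommGroup H] [InnerProductSpace 𝕜 H]
  [LinearOrder ι] [LocallyFiniteOrderBot ι] [WellFoundedLT ι]

theorem gramSchmidt_mem_of_pairwise_isOrtho {E : κ → Submodule 𝕜 H}
    (hE : Pairwise fun a b => E a ⟂ E b) {v : ι → H} {c : ι → κ} (hv : ∀ j, v j ∈ E (c j))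
    (j : ι) : InnerProductSpace.gramSchmidt 𝕜 v j ∈ E (c j) := by
  induction j using WellFoundedLT.induction with
  | ind j ih =>
    rw [InnerProductSpace.gramSchmidt_def]
    refine Submodule.sub_mem _ (hv j) (Submodule.sum_mem _ fun i hi => ?_)
    have hgi := ih i (Finset.mem_Iio.mp hi)
    rw [Submodule.starProjection_singleton]
    by_cases hc : c i = c j
    · exact Submodule.smul_mem _ _ (hc ▸ hgi)
    · rw [(hE hc).inner_eq hgi (hv j), zero_div, zero_smul]
      exact Submodule.zero_mem _

theorem exists_orthonormal_of_pairwise_isOrtho {E : κ → Submodule 𝕜 H}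
    (hE : Pairwise fun a b => E a ⟂ E b) {v : ι → H} (hv : LinearIndependent 𝕜 v) {c : ι → κ}
    (hvE : ∀ j, v j ∈ E (c j)) : ∃ u : ι → H, Orthonormal 𝕜 u ∧ ∀ j, u j ∈ E (c j) :=
  ⟨InnerProductSpace.gramSchmidtNormed 𝕜 v, InnerProductSpace.gramSchmidtNormed_orthonormal hv,
    fun j => Submodule.smul_mem _ _ (gramSchmidt_mem_of_pairwise_isOrtho hE hvE j)⟩

end Orthonormalization

section FormEigenspace

variable {𝕜 H K : Type*} [RCLike 𝕜] [NormedAddCommGroup H] [InnerProductSpace 𝕜 H]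
  [NormedAddCommGroup K] [InnerProductSpace 𝕜 K]

/-- The eigenspace for `ν` of the quadratic form `u ↦ ‖D u‖²`, where the operator `D` from `H` to
`K` is given by its graph `G`: it consists of the `u` in the domain of `D` with
`⟪D w, D u⟫ = ν ⟪w, u⟫` for all `w` in the domain of `D`. -/
def formEigenspace (G : Submodule 𝕜 (H × K)) (ν : ℝ) : Submodule 𝕜 H where
  carrier := {u | ∃ U, (u, U) ∈ G ∧ ∀ w ∈ G, inner 𝕜 w.2 U = ν * inner 𝕜 w.1 u}
  zero_mem' := ⟨0, G.zero_mem, fun w _ => by simp⟩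
  add_mem' := by
    rintro u u' ⟨U, hU, hν⟩ ⟨U', hU', hν'⟩
    refine ⟨U + U', G.add_mem hU hU', fun w hw => ?_⟩
    rw [inner_add_right, inner_add_right, hν w hw, hν' w hw, mul_add]
  smul_mem' := by
    rintro a u ⟨U, hU, hν⟩
    refine ⟨a • U, G.smul_mem a hU, fun w hw => ?_⟩
    rw [inner_smul_right, inner_smul_right, hν w hw, mul_left_comm]

variable {G : Submodule 𝕜 (H × K)}

theorem exists_mem_norm_sq_eq_of_mem_formEigenspace {ν : ℝ} {u : H}
    (hu : u ∈ formEigenspace G ν) : ∃ U, (u, U) ∈ G ∧ ‖U‖ ^ 2 = ν * ‖u‖ ^ 2 := by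
  obtain ⟨U, hU, hν⟩ := hu
  refine ⟨U, hU, ?_⟩
  have h := hν (u, U) hU
  rw [inner_self_eq_norm_sq_to_K, inner_self_eq_norm_sq_to_K] at h
  exact_mod_cast h

theorem pairwise_isOrtho_formEigenspace :
    Pairwise fun ν ν' => formEigenspace G ν ⟂ formEigenspace G ν' := by
  intro ν ν' hne
  refine Submodule.isOrtho_iff_inner_eq.mpr fun u hu w hw => ?_
  obtain ⟨U, hU, hν⟩ := hu
  obtain ⟨W, hW, hν'⟩ := hw
  have symmetry : (ν : 𝕜) * inner 𝕜 u w = ν' * inner 𝕜 u w := by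
    rw [← hν' _ hU, ← inner_conj_symm u, ← inner_conj_symm U, hν _ hW, map_mul,
      RCLike.conj_ofReal]
  have : ((ν : 𝕜) - ν') * inner 𝕜 u w = 0 := by rw [sub_mul, symmetry, sub_self]
  exact (mul_eq_zero.mp this).resolve_left (sub_ne_zero.mpr (by exact_mod_cast hne))

theorem exists_orthonormal_forall_mem_norm_sq_le {k : ℕ} (μ : Fin k → ℝ)
    (hμ : ∀ j : Fin k, ∃ u : Fin (j + 1) → H, LinearIndependent 𝕜 u ∧
      ∀ i, ∃ ν ≤ μ j, u i ∈ formEigenspace G ν) :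
    ∃ p : Fin k → H × K, Orthonormal 𝕜 (fun j => (p j).1) ∧ ∀ j, p j ∈ G ∧ ‖(p j).2‖ ^ 2 ≤ μ j := by
  obtain ⟨v, hv, hvμ⟩ := exists_linearIndependent_forall_mem
    (fun j => {u | ∃ ν ≤ μ j, u ∈ formEigenspace G ν}) hμ
  choose ν hνμ hvν using hvμ
  obtain ⟨u, hu, huν⟩ := exists_orthonormal_of_pairwise_isOrtho
    pairwise_isOrtho_formEigenspace hv hvν
  choose U hU hnorm using fun j => exists_mem_norm_sq_eq_of_mem_formEigenspace (huν j)
  refine ⟨fun j => (u j, U j), hu, fun j => ⟨hU j, ?_⟩⟩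
  simpa [hnorm j, hu.1 j] using hνμ j

end FormEigenspace

section Symbol

variable {V F ι : Type*} [NormedAddCommGroup V] [InnerProductSpace ℝ V]
  [NormedAddCommGroup F] [NormedSpace ℂ F]

/-- The Fourier symbol `∏ⱼ 2πi ⟪ξ, v j⟫` of the iterated directional derivative
`∂_{v 0} ⋯ ∂_{v (m-1)}`. -/
def lineDerivSymbol {m : ℕ} (v : Fin m → V) (ξ : V) : ℂ :=
  ∏ j, ((2 * Real.pi * inner ℝ ξ (v j) : ℝ) : ℂ) * Complex.I

theorem norm_lineDerivSymbol_sq {m : ℕ} (v : Fin m → V) (ξ : V) :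
    ‖lineDerivSymbol v ξ‖ ^ 2 = ∏ j, (2 * Real.pi * inner ℝ ξ (v j)) ^ 2 := by
  simp only [lineDerivSymbol, norm_prod, norm_mul, Complex.norm_I, mul_one, Complex.norm_real,
    ← Finset.prod_pow, Real.norm_eq_abs, mul_pow, sq_abs]

theorem lineDerivSymbol_sq {m : ℕ} (v : Fin m → V) (ξ : V) :
    lineDerivSymbol v ξ ^ 2 = (-1) ^ m * ((‖lineDerivSymbol v ξ‖ ^ 2 : ℝ) : ℂ) := by
  rw [norm_lineDerivSymbol_sq, lineDerivSymbol, Finset.prod_mul_distrib, mul_pow,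
    Finset.prod_const, Finset.card_univ, Fintype.card_fin, ← pow_mul, mul_comm m, pow_mul,
    Complex.I_sq, mul_comm, Finset.prod_pow, Complex.ofReal_pow, Complex.ofReal_prod]

theorem sum_norm_lineDerivSymbol_sq [Fintype ι] (b : OrthonormalBasis ι ℝ V) (l : ℕ) (ξ : V) :
    ∑ α : Fin l → ι, ‖lineDerivSymbol (b ∘ α) ξ‖ ^ 2 = (2 * Real.pi * ‖ξ‖) ^ (2 * l) := by
  simp only [norm_lineDerivSymbol_sq, Function.comp_apply]
  rw [← Fintype.sum_pow (fun i => (2 * Real.pi * inner ℝ ξ (b i)) ^ 2) l, pow_mul,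
    mul_pow _ ‖ξ‖, ← b.sum_sq_inner_left ξ, Finset.mul_sum]
  simp only [mul_pow]

variable [FiniteDimensional ℝ V] [MeasurableSpace V] [BorelSpace V]

theorem fourier_lineDerivOp_apply (v : V) (f : 𝓢(V, F)) (ξ : V) :
    𝓕 (∂_{v} f) ξ = (((2 * Real.pi * inner ℝ ξ v : ℝ) : ℂ) * Complex.I) • 𝓕 f ξ := by
  have growth : (inner ℝ · v : V → ℝ).HasTemperateGrowth :=
    ((innerSL ℝ).flip v).hasTemperateGrowth
  rw [fourier_lineDerivOp_eq, smul_apply, smulLeftCLM_apply_apply growth, ← Complex.coe_smul,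
    smul_smul]
  congr 1
  push_cast
  ring

theorem fourier_iteratedLineDerivOp_apply {m : ℕ} (v : Fin m → V) (f : 𝓢(V, F)) (ξ : V) :
    𝓕 (∂^{v} f) ξ = lineDerivSymbol v ξ • 𝓕 f ξ := by
  induction m with
  | zero => simp [lineDerivSymbol]
  | succ m ih =>
    rw [LineDeriv.iteratedLineDerivOp_succ_left, fourier_lineDerivOp_apply, ih, smul_smul]
    simp only [lineDerivSymbol, Fin.prod_univ_succ, Fin.tail]

theorem fourier_neg_laplacian_apply (f : 𝓢(V, F)) (ξ : V) :
    𝓕 (-Δ f) ξ = (((2 * Real.pi * ‖ξ‖) ^ 2 : ℝ) : ℂ) • 𝓕 f ξ := by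
  rw [laplacian_eq_sum (stdOrthonormalBasis ℝ V), FourierTransform.fourier_neg, neg_apply,
    FourierTransform.fourier_sum, sum_apply]
  simp only [fourier_lineDerivOp_apply, smul_smul, mul_mul_mul_comm _ Complex.I, Complex.I_mul_I,
    mul_neg_one, ← Complex.ofReal_mul]
  rw [← Finset.sum_smul, ← neg_smul, Finset.sum_neg_distrib, neg_neg, ← Complex.ofReal_sum,
    mul_pow, ← (stdOrthonormalBasis ℝ V).sum_sq_inner_left ξ, Finset.mul_sum]
  simp only [← sq, mul_pow]

theorem fourier_iterate_neg_laplacian_apply (l : ℕ) (f : 𝓢(V, F)) (ξ : V) :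
    𝓕 ((fun g : 𝓢(V, F) => -Δ g)^[l] f) ξ =
      (((2 * Real.pi * ‖ξ‖) ^ (2 * l) : ℝ) : ℂ) • 𝓕 f ξ := by
  induction l with
  | zero => simp
  | succ l ih =>
    rw [Function.iterate_succ_apply', fourier_neg_laplacian_apply, ih, smul_smul,
      ← Complex.ofReal_mul, ← pow_add, mul_add_one, add_comm]

theorem iterate_neg_laplacian_eq_sum [CompleteSpace F] [Fintype ι] (b : OrthonormalBasis ι ℝ V)
    (l : ℕ) (f : 𝓢(V, F)) :
    (fun g : 𝓢(V, F) => -Δ g)^[l] f =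
      (-1 : ℂ) ^ l • ∑ α : Fin l → ι, ∂^{b ∘ α} (∂^{b ∘ α} f) := by
  apply (fourierEquiv ℂ 𝓢(V, F)).injective
  ext ξ
  rw [fourierEquiv_apply, fourierEquiv_apply, fourier_iterate_neg_laplacian_apply,
    FourierTransform.fourier_smul, FourierTransform.fourier_sum, smul_apply, sum_apply]
  simp only [fourier_iteratedLineDerivOp_apply, smul_smul, ← sq, lineDerivSymbol_sq]
  rw [← Finset.sum_smul, ← Finset.mul_sum, ← Complex.ofReal_sum, sum_norm_lineDerivSymbol_sq,
    smul_smul, ← mul_assoc, ← mul_pow, neg_one_mul, neg_neg, one_pow, one_mul]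

end Symbol

section TestFunction

variable {n : ℕ} {Ω : Opens (EuclideanSpace ℝ (Fin n))}

/-- A test function as a Schwartz function. -/
def toSchwartz (φ : 𝓓(Ω, ℂ)) : 𝓢(EuclideanSpace ℝ (Fin n), ℂ) :=
  φ.hasCompactSupport.toSchwartzMap φ.contDiff

theorem testFunction_lineDerivOp_apply (φ : 𝓓(Ω, ℂ)) (v x : EuclideanSpace ℝ (Fin n)) :
    (∂_{v} φ) x = lineDeriv ℝ φ x v := by
  rw [TestFunction.lineDerivOp_eq_lineDerivCLM ℝ]
  exact TestFunction.lineDerivCLM_apply_of_le (by simp)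

theorem toSchwartz_lineDerivOp (φ : 𝓓(Ω, ℂ)) (v : EuclideanSpace ℝ (Fin n)) :
    toSchwartz (∂_{v} φ) = ∂_{v} (toSchwartz φ) := by
  ext x
  rw [SchwartzMap.lineDerivOp_apply]
  exact testFunction_lineDerivOp_apply φ v x

theorem toSchwartz_partialDeriv {m : ℕ} (α : Fin m → Fin n) (φ : 𝓓(Ω, ℂ)) :
    toSchwartz (partialDeriv α φ) = ∂^{EuclideanSpace.basisFun (Fin n) ℝ ∘ α} (toSchwartz φ) := by
  have basis : EuclideanSpace.basisFun (Fin n) ℝ ∘ α =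
      fun i => EuclideanSpace.single (α i) (1 : ℝ) := by ext; simp
  rw [basis]
  induction m with
  | zero => rfl
  | succ m ih =>
    rw [LineDeriv.iteratedLineDerivOp_succ_left]
    exact (toSchwartz_lineDerivOp _ _).trans (congrArg _ (ih (Fin.tail α) (by ext; simp)))

theorem negLaplacianPow_coe_schwartzMap (l : ℕ) (f : 𝓢(EuclideanSpace ℝ (Fin n), ℂ)) :
    negLaplacianPow l f = (fun g : 𝓢(EuclideanSpace ℝ (Fin n), ℂ) => -Δ g)^[l] f := by
  unfold negLaplacianPow
  induction l with
  | zero => rfl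
  | succ l ih =>
    rw [Function.iterate_succ_apply', Function.iterate_succ_apply', ih]
    ext x
    rw [Pi.neg_apply, neg_apply, SchwartzMap.laplacian_apply]

theorem negLaplacianPow_eq_sum_partialDeriv (l : ℕ) (φ : 𝓓(Ω, ℂ))
    (x : EuclideanSpace ℝ (Fin n)) :
    negLaplacianPow l φ x =
      (-1 : ℂ) ^ l * ∑ α : Fin l → Fin n, partialDeriv α (partialDeriv α φ) x := by
  have h := congrFun (negLaplacianPow_coe_schwartzMap l (toSchwartz φ)) x
  rw [iterate_neg_laplacian_eq_sum (EuclideanSpace.basisFun (Fin n) ℝ), smul_apply,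
    sum_apply] at h
  simp only [← toSchwartz_partialDeriv] at h
  exact h

/-- The complex conjugate of a test function; it turns the bilinear pairings of distributions into
inner products of `L²(Ω)`. -/
def conjTest (φ : 𝓓(Ω, ℂ)) : 𝓓(Ω, ℂ) :=
  TestFunction.postcompCLM (Complex.conjCLE : ℂ →L[ℝ] ℂ) φ

theorem partialDeriv_conjTest {m : ℕ} (α : Fin m → Fin n) (φ : 𝓓(Ω, ℂ)) :
    partialDeriv α (conjTest φ) = conjTest (partialDeriv α φ) := by
  have lineDerivOp_conjTest : ∀ (ψ : 𝓓(Ω, ℂ)) (v : EuclideanSpace ℝ (Fin n)),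
      ∂_{v} (conjTest ψ) = conjTest (∂_{v} ψ) := fun ψ v => by
    ext x
    have hψ : HasFDerivAt ψ (fderiv ℝ ψ x) x :=
      (ψ.contDiff.differentiable (by simp)).differentiableAt.hasFDerivAt
    calc (∂_{v} (conjTest ψ)) x = lineDeriv ℝ (Complex.conjCLE ∘ ψ) x v :=
          testFunction_lineDerivOp_apply _ _ _
      _ = Complex.conjCLE (fderiv ℝ ψ x v) :=
          ((Complex.conjCLE : ℂ →L[ℝ] ℂ).hasFDerivAt.comp x hψ).hasLineDerivAt v |>.lineDeriv
      _ = conjTest (∂_{v} ψ) x := by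
          rw [← (hψ.hasLineDerivAt v).lineDeriv, ← testFunction_lineDerivOp_apply]; rfl
  induction m with
  | zero => rfl
  | succ m ih => exact (congrArg _ (ih (Fin.tail α))).trans (lineDerivOp_conjTest _ _)

theorem memLp_testFunction (φ : 𝓓(Ω, ℂ)) :
    MemLp φ 2 ((volume : Measure (EuclideanSpace ℝ (Fin n))).restrict Ω) :=
  (φ.continuous.memLp_of_hasCompactSupport φ.hasCompactSupport).restrict _

/-- A test function as an element of `L²(Ω)`. -/
def toL2 : 𝓓(Ω, ℂ) →ₗ[ℂ] L2 Ω where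
  toFun φ := (memLp_testFunction φ).toLp
  map_add' _ _ := rfl
  map_smul' _ _ := rfl

theorem coeFn_toL2 (φ : 𝓓(Ω, ℂ)) :
    toL2 φ =ᵐ[(volume : Measure (EuclideanSpace ℝ (Fin n))).restrict Ω] φ :=
  (memLp_testFunction φ).coeFn_toLp

theorem tendsto_toL2_iff {φ : ℕ → 𝓓(Ω, ℂ)} {v : L2 Ω} :
    Tendsto (fun i => toL2 (φ i)) atTop (𝓝 v) ↔
      Tendsto (fun i => eLpNorm (fun x => φ i x - v x) 2
        ((volume : Measure (EuclideanSpace ℝ (Fin n))).restrict Ω)) atTop (𝓝 0) := by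
  rw [Lp.tendsto_Lp_iff_tendsto_eLpNorm']
  refine tendsto_congr fun i => eLpNorm_congr_ae ?_
  filter_upwards [coeFn_toL2 (φ i)] with x hx
  rw [Pi.sub_apply, hx]

theorem integral_mul_conjTest (u : L2 Ω) (φ : 𝓓(Ω, ℂ)) :
    ∫ x in Ω, u x * conjTest φ x = inner ℂ (toL2 φ) u := by
  rw [L2.inner_def]
  refine integral_congr_ae ?_
  filter_upwards [coeFn_toL2 φ] with x hx
  rw [hx, RCLike.inner_apply]
  rfl

theorem eq_zero_of_forall_inner_toL2_eq_zero {w : L2 Ω}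
    (hw : ∀ φ : 𝓓(Ω, ℂ), inner ℂ (toL2 φ) w = 0) : w = 0 := by
  have key : ∀ᵐ x ∂(volume : Measure (EuclideanSpace ℝ (Fin n))), x ∈ (Ω : Set _) → w x = 0 := by
    refine Ω.isOpen.ae_eq_zero_of_integral_contDiff_smul_eq_zero
      (locallyIntegrableOn_of_locallyIntegrable_restrict
        ((Lp.memLp w).locallyIntegrable (by norm_num))) fun g hg hgc hgs => ?_
    let φ : 𝓓(Ω, ℂ) := ⟨fun x => (g x : ℂ), Complex.ofRealCLM.contDiff.comp hg,
      hgc.comp_left Complex.ofReal_zero, (tsupport_comp_subset Complex.ofReal_zero g).trans hgs⟩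
    calc ∫ x, g x • w x = ∫ x in Ω, g x • w x :=
          (setIntegral_eq_integral_of_forall_compl_eq_zero fun x hx => by
            rw [image_eq_zero_of_notMem_tsupport fun hxs => hx (hgs hxs), zero_smul]).symm
      _ = ∫ x in Ω, w x * conjTest φ x := by
          refine integral_congr_ae (.of_forall fun x => ?_)
          change g x • w x = w x * starRingEnd ℂ (g x : ℂ)
          rw [Complex.conj_ofReal, mul_comm, Complex.real_smul]
      _ = 0 := by rw [integral_mul_conjTest, hw φ]
  refine Lp.ext ?_
  filter_upwards [(ae_restrict_iff' Ω.isOpen.measurableSet).mpr key, Lp.coeFn_zero ℂ 2 _]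
    with x hx h0
  rw [hx, h0, Pi.zero_apply]

end TestFunction

section Sobolev

variable {n : ℕ} {Ω : Opens (EuclideanSpace ℝ (Fin n))}

theorem IsWeakPartialDeriv.inner_toL2_partialDeriv {m : ℕ} {α : Fin m → Fin n} {u v : L2 Ω}
    (h : IsWeakPartialDeriv α u v) (φ : 𝓓(Ω, ℂ)) :
    inner ℂ (toL2 (partialDeriv α φ)) u = (-1 : ℂ) ^ m * inner ℂ (toL2 φ) v := by
  rw [← integral_mul_conjTest, ← integral_mul_conjTest, ← partialDeriv_conjTest]
  exact h (conjTest φ)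

theorem IsWeakPartialDeriv.eq_of_order_zero {α : Fin 0 → Fin n} {u v : L2 Ω}
    (h : IsWeakPartialDeriv α u v) : v = u := by
  refine sub_eq_zero.mp (eq_zero_of_forall_inner_toL2_eq_zero fun φ => ?_)
  have := h.inner_toL2_partialDeriv φ
  rw [pow_zero, one_mul] at this
  rw [inner_sub_right, ← this, sub_eq_zero]
  rfl

theorem integral_mul_negLaplacianPow_conjTest {l : ℕ} {u : L2 Ω} {U : (Fin l → Fin n) → L2 Ω}
    (hU : ∀ α, IsWeakPartialDeriv α u (U α)) (φ : 𝓓(Ω, ℂ)) :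
    ∫ x in Ω, u x * negLaplacianPow l (conjTest φ) x =
      ∑ α, inner ℂ (toL2 (partialDeriv α φ)) (U α) := by
  calc ∫ x in Ω, u x * negLaplacianPow l (conjTest φ) x
      = ∫ x in Ω, ∑ α : Fin l → Fin n,
          (-1 : ℂ) ^ l * (u x * conjTest (partialDeriv α (partialDeriv α φ)) x) := by
        simp only [negLaplacianPow_eq_sum_partialDeriv, partialDeriv_conjTest, ← Finset.mul_sum]
        simp only [mul_left_comm]
    _ = ∑ α : Fin l → Fin n,
          (-1 : ℂ) ^ l * inner ℂ (toL2 (partialDeriv α (partialDeriv α φ))) u := by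
        simp only [← integral_mul_conjTest, ← integral_const_mul]
        exact integral_finsetSum _ fun α _ =>
          ((Lp.memLp u).integrable_mul (memLp_testFunction _)).const_mul _
    _ = ∑ α, inner ℂ (toL2 (partialDeriv α φ)) (U α) := by
        simp only [(hU _).inner_toL2_partialDeriv, ← mul_assoc, ← mul_pow, neg_one_mul, neg_neg,
          one_pow, one_mul]

/-- A test function together with all its partial derivatives of order `l`, in `L²(Ω)`. -/
def jet (l : ℕ) : 𝓓(Ω, ℂ) →ₗ[ℂ] L2 Ω × PiLp 2 fun _ : Fin l → Fin n => L2 Ω where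
  toFun φ := (toL2 φ, WithLp.toLp 2 fun α => toL2 (partialDeriv α φ))
  map_add' φ ψ := by
    simp only [partialDeriv, LineDeriv.iteratedLineDerivOp_add, map_add]
    rfl
  map_smul' c φ := by
    simp only [partialDeriv, LineDeriv.iteratedLineDerivOp_smul, map_smul]
    rfl

variable (Ω) in
/-- The graph of the gradient of order `l` on `H₀ˡ(Ω)`: the closure of the jets of test
functions. -/
def sobolevGraph (l : ℕ) : Submodule ℂ (L2 Ω × PiLp 2 fun _ : Fin l → Fin n => L2 Ω) :=
  (LinearMap.range (jet l)).topologicalClosure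

variable {l : ℕ}

theorem sobolevGraph_subset {S : Set (L2 Ω × PiLp 2 fun _ : Fin l → Fin n => L2 Ω)}
    (hS : IsClosed S) (hjet : ∀ φ, jet l φ ∈ S) : (sobolevGraph Ω l : Set _) ⊆ S :=
  closure_minimal (by rintro _ ⟨φ, rfl⟩; exact hjet φ) hS

theorem MemH0.exists_mem_sobolevGraph {u : L2 Ω} (hu : MemH0 l u) :
    ∃ U, (u, U) ∈ sobolevGraph Ω l ∧ ∀ α, IsWeakPartialDeriv α u (U α) := by
  obtain ⟨v, hv, φ, hφ⟩ := hu
  have hφu : Tendsto (fun i => toL2 (φ i)) atTop (𝓝 u) := by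
    have := tendsto_toL2_iff.mpr (hφ 0 (Nat.zero_le l) Fin.elim0)
    rwa [(hv 0 (Nat.zero_le l) Fin.elim0).eq_of_order_zero] at this
  have hφU : Tendsto (fun i => WithLp.toLp 2 fun α => toL2 (partialDeriv α (φ i))) atTop
      (𝓝 (WithLp.toLp 2 (v l))) :=
    (PiLp.continuous_toLp 2 _).continuousAt.tendsto.comp
      (tendsto_pi_nhds.mpr fun α => tendsto_toL2_iff.mpr (hφ l le_rfl α))
  exact ⟨WithLp.toLp 2 (v l), mem_closure_of_tendsto (hφu.prodMk_nhds hφU)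
    (.of_forall fun i => ⟨φ i, rfl⟩), hv l le_rfl⟩

theorem IsDirichletEigenfunction.mem_formEigenspace {ν : ℝ} {u : L2 Ω}
    (hu : IsDirichletEigenfunction l ν u) : u ∈ formEigenspace (sobolevGraph Ω l) ν := by
  obtain ⟨-, hu0, heq⟩ := hu
  obtain ⟨U, huU, hU⟩ := hu0.exists_mem_sobolevGraph
  refine ⟨U, huU, sobolevGraph_subset (isClosed_eq (by fun_prop) (by fun_prop)) fun φ => ?_⟩
  calc inner ℂ (jet l φ).2 U = ∑ α, inner ℂ (toL2 (partialDeriv α φ)) (U α) :=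
        PiLp.inner_apply _ _
    _ = ∫ x in Ω, u x * negLaplacianPow l (conjTest φ) x :=
        (integral_mul_negLaplacianPow_conjTest hU φ).symm
    _ = ν * ∫ x in Ω, u x * conjTest φ x := heq (conjTest φ)
    _ = ν * inner ℂ (jet l φ).1 u := by rw [integral_mul_conjTest]; rfl

theorem fourierOn_toL2 (φ : 𝓓(Ω, ℂ)) : fourierOn (toL2 φ) = 𝓕 (φ : _ → ℂ) := by
  ext ξ
  rw [fourierOn, Real.fourier_eq, Real.fourier_eq]
  refine integral_congr_ae ?_
  filter_upwards [(ae_restrict_iff' Ω.isOpen.measurableSet).mp (coeFn_toL2 φ)] with x hx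
  by_cases hxΩ : x ∈ (Ω : Set (EuclideanSpace ℝ (Fin n)))
  · rw [Set.indicator_of_mem hxΩ, hx hxΩ]
  · rw [Set.indicator_of_notMem hxΩ,
      image_eq_zero_of_notMem_tsupport fun hxs => hxΩ (φ.tsupport_subset hxs)]

variable [IsFiniteMeasure ((volume : Measure (EuclideanSpace ℝ (Fin n))).restrict Ω)]
  {p : L2 Ω × PiLp 2 fun _ : Fin l → Fin n => L2 Ω}

theorem fourierOn_snd_of_mem_sobolevGraph (hp : p ∈ sobolevGraph Ω l) (α : Fin l → Fin n)
    (ξ : EuclideanSpace ℝ (Fin n)) :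
    fourierOn (p.2 α) ξ =
      lineDerivSymbol (EuclideanSpace.basisFun (Fin n) ℝ ∘ α) ξ * fourierOn p.1 ξ := by
  refine sobolevGraph_subset
    (S := {p : L2 Ω × PiLp 2 fun _ : Fin l → Fin n => L2 Ω | fourierOn (p.2 α) ξ =
      lineDerivSymbol (EuclideanSpace.basisFun (Fin n) ℝ ∘ α) ξ * fourierOn p.1 ξ}) ?_ ?_ hp
  · simp only [fourierOn_eq_inner Ω.isOpen.measurableSet]
    exact isClosed_eq (by fun_prop) (by fun_prop)
  · intro φ
    change fourierOn (toL2 (partialDeriv α φ)) ξ = _ * fourierOn (toL2 φ) ξ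
    rw [fourierOn_toL2, fourierOn_toL2]
    have := fourier_iteratedLineDerivOp_apply (EuclideanSpace.basisFun (Fin n) ℝ ∘ α)
      (toSchwartz φ) ξ
    rwa [← toSchwartz_partialDeriv] at this

theorem lintegral_two_pi_norm_pow_mul_enorm_fourierOn_sq (hp : p ∈ sobolevGraph Ω l) :
    ∫⁻ ξ, ENNReal.ofReal ((2 * Real.pi * ‖ξ‖) ^ (2 * l)) * ‖fourierOn p.1 ξ‖ₑ ^ 2 =
      ‖p.2‖ₑ ^ 2 := by
  have hΩ := Ω.isOpen.measurableSet
  have hnorm : ‖p.2‖ₑ ^ 2 = ∑ α, ‖p.2 α‖ₑ ^ 2 := by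
    simp only [← ofReal_norm, ← ENNReal.ofReal_pow (norm_nonneg _)]
    rw [PiLp.norm_sq_eq_of_L2, ENNReal.ofReal_sum_of_nonneg fun _ _ => by positivity]
  simp only [hnorm, ← lintegral_enorm_fourierOn_sq hΩ]
  rw [← lintegral_finsetSum _ fun α _ =>
    (continuous_fourierOn hΩ (p.2 α)).measurable.enorm.pow_const 2]
  refine lintegral_congr fun ξ => ?_
  rw [← sum_norm_lineDerivSymbol_sq (EuclideanSpace.basisFun (Fin n) ℝ),
    ENNReal.ofReal_sum_of_nonneg fun _ _ => by positivity, Finset.sum_mul]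
  simp only [fourierOn_snd_of_mem_sobolevGraph hp, enorm_mul, mul_pow,
    ENNReal.ofReal_pow (norm_nonneg _), ofReal_norm]

end Sobolev

section Conclusion

theorem le_sum_rpow_of_forall_lt {ι : Type*} [Fintype ι] {a : ι → ℝ≥0∞} {b : ℝ≥0∞} {q : ℝ}
    (hq : 0 < q) (h : ∀ x : ι → ℝ≥0∞, (∀ i, a i < x i) → b ≤ ∑ i, x i ^ q) :
    b ≤ ∑ i, a i ^ q := by
  by_cases htop : ∃ i, a i = ∞
  · obtain ⟨i, hi⟩ := htop
    rw [ENNReal.sum_eq_top.mpr ⟨i, Finset.mem_univ i, by rw [hi, ENNReal.top_rpow_of_pos hq]⟩]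
    exact le_top
  push Not at htop
  have hlim : Tendsto (fun ε : ℝ≥0∞ => ∑ i, (a i + ε) ^ q) (𝓝[>] 0) (𝓝 (∑ i, a i ^ q)) := by
    have hcont : Continuous fun ε : ℝ≥0∞ => ∑ i, (a i + ε) ^ q :=
      continuous_finsetSum _ fun i _ =>
        ENNReal.continuous_rpow_const.comp (continuous_const.add continuous_id)
    simpa only [add_zero] using (hcont.tendsto 0).mono_left nhdsWithin_le_nhds
  refine ge_of_tendsto hlim ?_
  filter_upwards [self_mem_nhdsWithin] with ε hε
  exact h _ fun i => ENNReal.lt_add_right (htop i) (ne_of_gt hε)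

variable {n l k : ℕ} {Ω : Opens (EuclideanSpace ℝ (Fin n))} {q : ℝ}

theorem ofReal_liYauBound_le_sum_rpow_of_orthonormal (hn : 0 < n) (hq : 0 ≤ q) (hq1 : q ≤ 1)
    (hΩ : (Ω : Set (EuclideanSpace ℝ (Fin n))).Nonempty)
    (hΩv : volume (Ω : Set (EuclideanSpace ℝ (Fin n))) ≠ ∞)
    {p : Fin k → L2 Ω × PiLp 2 fun _ : Fin l → Fin n => L2 Ω}
    (hp : ∀ j, p j ∈ sobolevGraph Ω l) (hon : Orthonormal ℂ fun j => (p j).1) :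
    ENNReal.ofReal ((2 * Real.pi) ^ (2 * l * q) *
        liYauBound n (volume.real (Metric.ball (0 : EuclideanSpace ℝ (Fin n)) 1)) (2 * l * q) k
          (volume.real (Ω : Set (EuclideanSpace ℝ (Fin n))))) ≤
      ∑ j, (‖(p j).2‖ₑ ^ 2) ^ q := by
  have : Nonempty (Fin n) := ⟨⟨0, hn⟩⟩
  have : IsFiniteMeasure ((volume : Measure (EuclideanSpace ℝ (Fin n))).restrict Ω) :=
    isFiniteMeasure_restrict.mpr hΩv
  have hΩm := Ω.isOpen.measurableSet
  have hweight (ξ : EuclideanSpace ℝ (Fin n)) :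
      ENNReal.ofReal ((2 * Real.pi * ‖ξ‖) ^ (2 * l)) ^ q =
        ENNReal.ofReal ((2 * Real.pi) ^ (2 * l * q)) * ENNReal.ofReal (‖ξ‖ ^ (2 * l * q)) := by
    rw [ENNReal.ofReal_rpow_of_nonneg (by positivity) hq, ← Real.rpow_natCast,
      ← Real.rpow_mul (by positivity), ← ENNReal.ofReal_mul (by positivity),
      ← Real.mul_rpow (by positivity) (norm_nonneg ξ), Nat.cast_mul, Nat.cast_ofNat]
  have hmoment := ofReal_liYauBound_le_sum_lintegral hΩm (Ω.isOpen.measure_pos _ hΩ).ne' hon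
    (s := 2 * l * q) (by positivity)
  rw [finrank_euclideanSpace_fin, Fintype.card_fin] at hmoment
  rw [ENNReal.ofReal_mul (by positivity)]
  refine (mul_le_mul_right hmoment _).trans ?_
  rw [Finset.mul_sum]
  refine Finset.sum_le_sum fun j _ => ?_
  calc ENNReal.ofReal ((2 * Real.pi) ^ (2 * l * q)) *
        ∫⁻ ξ, ENNReal.ofReal (‖ξ‖ ^ (2 * l * q)) * ‖fourierOn (p j).1 ξ‖ₑ ^ 2
      = ∫⁻ ξ, ENNReal.ofReal ((2 * Real.pi * ‖ξ‖) ^ (2 * l)) ^ q *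
          ‖fourierOn (p j).1 ξ‖ₑ ^ 2 := by
        rw [← lintegral_const_mul' _ _ ENNReal.ofReal_ne_top]
        exact lintegral_congr fun ξ => by rw [hweight, mul_assoc (ENNReal.ofReal _)]
    _ ≤ (∫⁻ ξ, ENNReal.ofReal ((2 * Real.pi * ‖ξ‖) ^ (2 * l)) *
          ‖fourierOn (p j).1 ξ‖ₑ ^ 2) ^ q := by
        refine lintegral_rpow_mul_le (by fun_prop)
          ((continuous_fourierOn hΩm _).measurable.enorm.pow_const 2).aemeasurable ?_ hq hq1
        rw [lintegral_enorm_fourierOn_sq hΩm, ← ofReal_norm, hon.1 j]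
        simp only [ENNReal.ofReal_one, one_pow]
    _ = (‖(p j).2‖ₑ ^ 2) ^ q := by
        rw [lintegral_two_pi_norm_pow_mul_enorm_fourierOn_sq (hp j)]

end Conclusion

theorem dirichletEigenvalue_lt_iff {n l k : ℕ} {Ω : Opens (EuclideanSpace ℝ (Fin n))} {x : ℝ≥0∞} :
    dirichletEigenvalue Ω l k < x ↔ ∃ μ : ℝ, (∃ u : Fin k → L2 Ω, LinearIndependent ℂ u ∧
      ∀ i, ∃ ν ≤ μ, IsDirichletEigenfunction l ν (u i)) ∧ ENNReal.ofReal μ < x := by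
  simp only [dirichletEigenvalue, iInf_lt_iff, exists_prop]

theorem exists_orthonormal_mem_sobolevGraph {n l k : ℕ} {Ω : Opens (EuclideanSpace ℝ (Fin n))}
    {x : Fin k → ℝ≥0∞} (hx : ∀ j : Fin k, dirichletEigenvalue Ω l (j + 1) < x j) :
    ∃ p : Fin k → L2 Ω × PiLp 2 fun _ : Fin l → Fin n => L2 Ω,
      Orthonormal ℂ (fun j => (p j).1) ∧
      ∀ j, p j ∈ sobolevGraph Ω l ∧ ‖(p j).2‖ₑ ^ 2 ≤ x j := by
  choose μ hμ hμx using fun j => dirichletEigenvalue_lt_iff.mp (hx j)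
  have heigen (j : Fin k) : ∃ u : Fin (j + 1) → L2 Ω, LinearIndependent ℂ u ∧
      ∀ i, ∃ ν ≤ μ j, u i ∈ formEigenspace (sobolevGraph Ω l) ν := by
    obtain ⟨u, hu, huν⟩ := hμ j
    exact ⟨u, hu, fun i => (huν i).imp fun ν h => ⟨h.1, h.2.mem_formEigenspace⟩⟩
  obtain ⟨p, hon, hp⟩ := exists_orthonormal_forall_mem_norm_sq_le μ heigen
  refine ⟨p, hon, fun j => ⟨(hp j).1, ?_⟩⟩
  rw [← ofReal_norm, ← ENNReal.ofReal_pow (norm_nonneg _)]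
  exact (ENNReal.ofReal_le_ofReal (hp j).2).trans (hμx j).le

end Polyharmonic

end

theorem corollary1p3_general (n : ℕ) (hn : 0 < n) (l : ℕ) (q : ℝ) (hq : 0 < q) (hq1 : q ≤ 1)
    (Ω : Opens (EuclideanSpace ℝ (Fin n)))
    (hΩ : (Ω : Set (EuclideanSpace ℝ (Fin n))).Nonempty)
    (hΩv : volume (Ω : Set (EuclideanSpace ℝ (Fin n))) ≠ ∞) (k : ℕ) :
    ENNReal.ofReal
        ((n : ℝ) / (n + 2 * l * q) * (4 * Real.pi) ^ ((l : ℝ) * q) *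
          (Real.Gamma (1 + (n : ℝ) / 2) /
            (volume : Measure (EuclideanSpace ℝ (Fin n))).real Ω) ^ (2 * l * q / (n : ℝ)) *
          (k : ℝ) ^ (1 + 2 * l * q / (n : ℝ)))
      ≤ ∑ j ∈ Finset.Icc 1 k, Polyharmonic.dirichletEigenvalue Ω l j ^ q := by
  have hreindex : ∑ j ∈ Finset.Icc 1 k, Polyharmonic.dirichletEigenvalue Ω l j ^ q =
      ∑ j : Fin k, Polyharmonic.dirichletEigenvalue Ω l (j + 1) ^ q := by
    rw [Fin.sum_univ_eq_sum_range (fun j => Polyharmonic.dirichletEigenvalue Ω l (j + 1) ^ q) k,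
      Finset.range_eq_Ico,
      Finset.sum_Ico_add' (fun j => Polyharmonic.dirichletEigenvalue Ω l j ^ q) 0 k 1, zero_add]
    rfl
  have hconst := Polyharmonic.two_pi_rpow_mul_liYauBound hn (s := 2 * l * q) (m := k)
    (measureReal_nonneg (μ := volume) (s := (Ω : Set (EuclideanSpace ℝ (Fin n)))))
  rw [show 2 * (l : ℝ) * q / 2 = l * q by ring] at hconst
  rw [hreindex, ← hconst]
  refine Polyharmonic.le_sum_rpow_of_forall_lt hq fun x hx => ?_
  obtain ⟨p, hon, hp⟩ := Polyharmonic.exists_orthonormal_mem_sobolevGraph hx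
  exact (Polyharmonic.ofReal_liYauBound_le_sum_rpow_of_orthonormal hn hq.le hq1 hΩ hΩv
    (fun j => (hp j).1) hon).trans
      (Finset.sum_le_sum fun j _ => ENNReal.rpow_le_rpow (hp j).2 hq.le)

theorem corollary1p3 (n : ℕ) (hn : 2 ≤ n) (l : ℕ) (hl : 1 ≤ l) (q : ℝ) (hq : 0 < q) (hq1 : q ≤ 1)
    (Ω : Opens (EuclideanSpace ℝ (Fin n)))
    (hΩ : IsConnected (Ω : Set (EuclideanSpace ℝ (Fin n))))
    (hΩb : Bornology.IsBounded (Ω : Set (EuclideanSpace ℝ (Fin n))))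
    (k : ℕ) :
    ENNReal.ofReal
        ((n : ℝ) / (n + 2 * l * q) * (4 * Real.pi) ^ ((l : ℝ) * q) *
          (Real.Gamma (1 + (n : ℝ) / 2) /
            (volume : Measure (EuclideanSpace ℝ (Fin n))).real Ω) ^ (2 * l * q / (n : ℝ)) *
          (k : ℝ) ^ (1 + 2 * l * q / (n : ℝ)))
      ≤ ∑ j ∈ Finset.Icc 1 k, Polyharmonic.dirichletEigenvalue Ω l j ^ q :=
  corollary1p3_general n (by lia) l q hq hq1 Ω hΩ.nonempty hΩb.measure_lt_top.ne k
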